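/- Let $P=(p_1,\dots,p_k)$, $k\ge 1$, be a probability vector with positive rational entries, and let $N_P$ be the (infinite) set of positive integers $n$ such that, for every $i=1,\dots,k$, $np_i$ is an integer and $np_i>3$. Fix one of the families $B$, $C$, $D$. For each $n\in N_P$ let $W$ be a finite reflection group of type $B_{n-1}$ (respectively $C_{n-1}$, $D_{n-1}$), i.e. the group generated by the reflections in the roots of a root system in a Euclidean space that has a fundamental system $\alpha_1,\dots,\alpha_{n-1}$ with Dynkin diagram $B_{n-1}$ (respectively $C_{n-1}$, $D_{n-1}$), numbered from left to right along the diagram so that the double edge (respectively the fork) is at the right end. Let $W_P\le W$ be the parabolic subgroup associated with $P$, i.e. the subgroup generated by the reflections in those fundamental roots $\alpha_i$ for which $i\notin\{np_1,\ n(p_1+p_2),\ \dots,\ n(p_1+\cdots+p_{k-1})\}$. Then $$\lim_{\substack{n\to\infty\\ n\in N_P}}\frac1n\ln|W/W_P| \;=\; H(P)+(1-p_k)\ln 2,\qquad H(P)=-\sum_{i=1}^k p_i\ln p_i .$$ The right-hand side is called the reflective entropy of $P$. -/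

import Mathlib

open Filter Topology

noncomputable section

namespace ReflectiveEntropy

/-- The reflection `s_α` of the Euclidean space `V` in the hyperplane orthogonal to `α`. -/
def hyperplaneReflection {V : Type*} [NormedAddCommGroup V] [InnerProductSpace ℝ V] (α : V) :
    V ≃ₗᵢ[ℝ] V :=
  (Submodule.span ℝ {α})ᗮ.reflection

/-- The reflection group generated by the reflections `s_α`, `α ∈ S`. -/
def reflectionGroup {V : Type*} [NormedAddCommGroup V] [InnerProductSpace ℝ V] (S : Set V) :
    Subgroup (V ≃ₗᵢ[ℝ] V) :=
  Subgroup.closure (hyperplaneReflection '' S)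

/-- A (finite, reduced, not necessarily crystallographic) root system in a Euclidean space. -/
structure IsRootSystem {V : Type*} [NormedAddCommGroup V] [InnerProductSpace ℝ V]
    (Φ : Set V) : Prop where
  finite : Φ.Finite
  ne_zero : ∀ α ∈ Φ, α ≠ 0
  smul_mem_iff : ∀ α ∈ Φ, ∀ c : ℝ, c • α ∈ Φ ↔ c = 1 ∨ c = -1
  reflection_mem : ∀ α ∈ Φ, ∀ β ∈ Φ, hyperplaneReflection α β ∈ Φ

/-- `Δ` is an (ordered) fundamental system of roots of `Φ`. -/
structure IsFundamentalSystem {V : Type*} [NormedAddCommGroup V] [InnerProductSpace ℝ V]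
    (Φ : Set V) {m : ℕ} (Δ : Fin m → V) : Prop where
  mem : ∀ i, Δ i ∈ Φ
  linearIndependent : LinearIndependent ℝ Δ
  nonneg_or_nonpos : ∀ β ∈ Φ, ∃ c : Fin m → ℝ,
    β = ∑ i, c i • Δ i ∧ ((∀ i, 0 ≤ c i) ∨ (∀ i, c i ≤ 0))

/-- The three infinite families of Dynkin diagrams other than type `A`. -/
inductive DynkinFamily
  | B
  | C
  | D

/-- The Cartan matrix of the Dynkin diagram of the given family with `m` nodes. The nodes are
numbered from left to right, so that the double edge (types `B` and `C`) or the fork (type `D`)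
is at the right end. -/
def DynkinFamily.cartanMatrix : DynkinFamily → (m : ℕ) → Matrix (Fin m) (Fin m) ℤ
  | .B, m => CartanMatrix.B m
  | .C, m => CartanMatrix.C m
  | .D, m => CartanMatrix.D m

/-- The ordered fundamental system `Δ` has the Dynkin diagram of family `X` with `m` nodes:
`2 (α_i, α_j) / (α_j, α_j)` is the `(i, j)` Cartan number. -/
def HasDynkinDiagram {V : Type*} [NormedAddCommGroup V] [InnerProductSpace ℝ V]
    (X : DynkinFamily) {m : ℕ} (Δ : Fin m → V) : Prop :=
  ∀ i j, 2 * inner ℝ (Δ i) (Δ j) / inner ℝ (Δ j) (Δ j) = (X.cartanMatrix m i j : ℝ)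

/-- The set `N_P` of positive integers `n` such that every `n p_i` is an integer greater
than `3`. -/
def admissible {k : ℕ} (P : Fin k → ℚ) : Set ℕ :=
  {n | 0 < n ∧ ∀ i, (∃ a : ℤ, (n : ℚ) * P i = a) ∧ 3 < (n : ℚ) * P i}

/-- The node `i` (counted from `0`; it is the `(i + 1)`-th root of the diagram) is excluded if
`i + 1 = n (p_1 + ⋯ + p_j)` for one of the proper initial segments `(p_1, …, p_j)` of the vector
`P`, that is, for some `j` other than the last index. -/
def IsExcluded {k : ℕ} (P : Fin (k + 1) → ℚ) (n : ℕ) {m : ℕ} (i : Fin m) : Prop :=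
  ∃ j : Fin (k + 1), j ≠ Fin.last k ∧ ((i : ℕ) + 1 : ℚ) = n * ∑ l ∈ Finset.Iic j, P l

/-- The parabolic subgroup `W_P` associated with `P`: it is generated by the reflections in the
fundamental roots that are not excluded. -/
def parabolicSubgroup {V : Type*} [NormedAddCommGroup V] [InnerProductSpace ℝ V]
    {k : ℕ} (P : Fin (k + 1) → ℚ) (n : ℕ) {m : ℕ} (Δ : Fin m → V) :
    Subgroup (V ≃ₗᵢ[ℝ] V) :=
  reflectionGroup (Δ '' {i | ¬ IsExcluded P n i})

/-- Shannon entropy in nats. -/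
def shannonEntropy {k : ℕ} (P : Fin k → ℚ) : ℝ :=
  -∑ i, (P i : ℝ) * Real.log (P i)

/-- The reflective entropy of `P`. -/
def reflectiveEntropy {k : ℕ} (P : Fin (k + 1) → ℚ) : ℝ :=
  shannonEntropy P + (1 - (P (Fin.last k) : ℝ)) * Real.log 2

end ReflectiveEntropy

end

open ReflectiveEntropy

/-!
A root of minimal height among those whose reflection is not generated by the fundamental
reflections can be lowered by a fundamental reflection, so there is none, and `W` is generated by
the fundamental reflections. The Cartan matrix determines the Gram matrix of the fundamental roots
up to a factor, so these are, up to a factor, the standard roots `e i - e (i + 1)` and `e m`,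
`2 e m` or `e (m - 1) + e m` for an orthonormal family `e`. Hence `W` is the group of all signed
permutations of `n - 1` coordinates or, in type `D`, of those with an even number of sign changes.
Omitting nodes cuts the coordinates into blocks of sizes `b 1, …, b k`, and `W_P` consists of the
elements of `W` that preserve the blocks and change signs only in the last one. The sign condition
of type `D` does not affect the index, since a sign can be changed in the last block; so in all
three types `|W / W_P|` is the multinomial coefficient of `b 1, …, b k` times
`2 ^ (b 1 + ⋯ + b (k - 1))`. By Stirling's formula the first factor contributes `H(P)`, and the
second contributes `(1 - p_k) log 2`.
-/

namespace ReflectiveEntropy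

/-! ### Reflections and fundamental systems -/

section Reflections

variable {V : Type*} [NormedAddCommGroup V] [InnerProductSpace ℝ V]

theorem hyperplaneReflection_apply (α v : V) :
    hyperplaneReflection α v = v - (2 * inner ℝ α v / inner ℝ α α) • α := by
  rw [hyperplaneReflection, Submodule.reflection_orthogonal_apply,
    Submodule.reflection_singleton_apply, real_inner_self_eq_norm_sq]
  simp only [RCLike.ofReal_real_eq_id, id_eq, neg_sub, two_smul, ← add_smul]
  congr 2
  ring

theorem hyperplaneReflection_smul {c : ℝ} (hc : c ≠ 0) (α : V) :
    hyperplaneReflection (c • α) = hyperplaneReflection α := by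
  simp only [hyperplaneReflection, Submodule.span_singleton_smul_eq (IsUnit.mk0 c hc)]

theorem hyperplaneReflection_neg (α : V) :
    hyperplaneReflection (-α) = hyperplaneReflection α := by
  rw [← neg_one_smul ℝ α, hyperplaneReflection_smul (by norm_num)]

theorem hyperplaneReflection_inv (α : V) :
    (hyperplaneReflection α)⁻¹ = hyperplaneReflection α :=
  Submodule.reflection_inv

theorem hyperplaneReflection_map (w : V ≃ₗᵢ[ℝ] V) (α : V) :
    hyperplaneReflection (w α) = w * hyperplaneReflection α * w⁻¹ := by
  ext v
  have hinner : inner ℝ (w α) v = inner ℝ α (w⁻¹ v) := by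
    rw [← w.inner_map_map α]
    exact congrArg _ (w.apply_symm_apply v).symm
  have hcancel : w (w⁻¹ v) = v := w.apply_symm_apply v
  simp only [hyperplaneReflection_apply, LinearIsometryEquiv.coe_mul, Function.comp_apply,
    map_sub, map_smul, LinearIsometryEquiv.inner_map_map, hinner, hcancel]

theorem hyperplaneReflection_mem_reflectionGroup {S : Set V} {α : V} (h : α ∈ S) :
    hyperplaneReflection α ∈ reflectionGroup S :=
  Subgroup.subset_closure ⟨α, h, rfl⟩

theorem reflectionGroup_mono {S T : Set V} (h : S ⊆ T) :
    reflectionGroup S ≤ reflectionGroup T :=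
  Subgroup.closure_mono (Set.image_mono h)

theorem exists_hyperplaneReflection_eq_sub {ι : Type*} [Fintype ι] [DecidableEq ι] {v : ι → V}
    (hv : ∀ i, v i ≠ 0) {c : ι → ℝ} (hc : 0 ≤ c) (hβ : ∑ i, c i • v i ≠ 0) :
    ∃ i, ∃ t > 0, hyperplaneReflection (v i) (∑ j, c j • v j) =
      ∑ j, (c - Pi.single i t : ι → ℝ) j • v j := by
  set β := ∑ j, c j • v j with hβ_def
  have hpos : 0 < ∑ i, c i * inner ℝ (v i) β := by
    have hself : inner ℝ β β = ∑ i, c i * inner ℝ (v i) β := by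
      conv_lhs => rw [hβ_def, sum_inner]
      simp only [real_inner_smul_left, hβ_def]
    exact hself ▸ real_inner_self_pos.2 hβ
  obtain ⟨i, -, hi⟩ := Finset.exists_lt_of_sum_lt (s := Finset.univ)
    (f := fun _ : ι => (0 : ℝ)) (by simpa using hpos)
  have hinner : 0 < inner ℝ (v i) β := pos_of_mul_pos_right hi (hc i)
  refine ⟨i, 2 * inner ℝ (v i) β / inner ℝ (v i) (v i),
    div_pos (by positivity) (real_inner_self_pos.2 (hv i)), ?_⟩
  rw [hyperplaneReflection_apply]
  simp only [Pi.sub_apply, sub_smul, Finset.sum_sub_distrib, Pi.single_apply, ite_smul, zero_smul,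
    Finset.sum_ite_eq', Finset.mem_univ, if_true, hβ_def]

end Reflections

namespace IsFundamentalSystem

variable {V : Type*} [NormedAddCommGroup V] [InnerProductSpace ℝ V] {Φ : Set V} {m : ℕ}
  {Δ : Fin m → V}

theorem linearCombination_injective (hΔ : IsFundamentalSystem Φ Δ) :
    Function.Injective fun c : Fin m → ℝ => ∑ i, c i • Δ i :=
  hΔ.linearIndependent.fintypeLinearCombination_injective

theorem nonneg_of_pos_apply (hΔ : IsFundamentalSystem Φ Δ) {c : Fin m → ℝ}
    (hβ : ∑ i, c i • Δ i ∈ Φ) {j : Fin m} (hj : 0 < c j) : 0 ≤ c := by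
  obtain ⟨d, hd, hsign⟩ := hΔ.nonneg_or_nonpos _ hβ
  obtain rfl : c = d := hΔ.linearCombination_injective hd
  exact hsign.resolve_right fun h => (h j).not_gt hj

theorem mem_range_of_forall_ne_eq_zero (hΦ : IsRootSystem Φ) (hΔ : IsFundamentalSystem Φ Δ)
    {c : Fin m → ℝ} (hc : 0 ≤ c) (hβ : ∑ i, c i • Δ i ∈ Φ) {i : Fin m}
    (hi : ∀ j, j ≠ i → c j = 0) : ∑ i, c i • Δ i ∈ Set.range Δ := by
  have hsum : ∑ j, c j • Δ j = c i • Δ i :=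
    Finset.sum_eq_single i (fun j _ hj => by rw [hi j hj, zero_smul]) (by simp)
  rw [hsum] at hβ ⊢
  rcases (hΦ.smul_mem_iff _ (hΔ.mem i) _).1 hβ with h | h
  · exact ⟨i, by rw [h, one_smul]⟩
  · exact absurd (hc i) (by rw [h]; norm_num)

theorem hyperplaneReflection_mem_of_nonneg (hΦ : IsRootSystem Φ) (hΔ : IsFundamentalSystem Φ Δ)
    {c : Fin m → ℝ} (hc : 0 ≤ c) (hβ : ∑ i, c i • Δ i ∈ Φ) :
    hyperplaneReflection (∑ i, c i • Δ i) ∈ reflectionGroup (Set.range Δ) := by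
  let bad : Set (Fin m → ℝ) := {c | (0 ≤ c ∧ ∑ i, c i • Δ i ∈ Φ) ∧
    hyperplaneReflection (∑ i, c i • Δ i) ∉ reflectionGroup (Set.range Δ)}
  suffices hbad : bad = ∅ by
    by_contra h
    exact Set.eq_empty_iff_forall_notMem.1 hbad c ⟨⟨hc, hβ⟩, h⟩
  by_contra hne
  have hfin : bad.Finite := Set.Finite.of_finite_image
    (hΦ.finite.subset (Set.image_subset_iff.2 fun c hc => hc.1.2))
    hΔ.linearCombination_injective.injOn
  obtain ⟨d, ⟨⟨hd, hdΦ⟩, hdΓ⟩, hmin⟩ := Set.exists_min_image bad (fun d => ∑ i, d i) hfin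
    (Set.nonempty_iff_ne_empty.2 hne)
  obtain ⟨i, t, ht, hrefl⟩ := exists_hyperplaneReflection_eq_sub
    (fun i => hΦ.ne_zero _ (hΔ.mem i)) hd (hΦ.ne_zero _ hdΦ)
  have hsimple := hyperplaneReflection_mem_reflectionGroup (Set.mem_range_self (f := Δ) i)
  have hroot : ∑ j, (d - Pi.single i t : Fin m → ℝ) j • Δ j ∈ Φ :=
    hrefl ▸ hΦ.reflection_mem _ (hΔ.mem i) _ hdΦ
  have hnonneg : 0 ≤ (d - Pi.single i t : Fin m → ℝ) := by
    obtain ⟨j, hji, hj⟩ : ∃ j, j ≠ i ∧ d j ≠ 0 := by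
      by_contra! h
      exact hdΓ (hyperplaneReflection_mem_reflectionGroup
        (hΔ.mem_range_of_forall_ne_eq_zero hΦ hd hdΦ h))
    exact hΔ.nonneg_of_pos_apply hroot (j := j)
      (by simpa [hji] using (hd j).lt_of_ne' hj)
  have hheight : ¬ ∑ j, d j ≤ ∑ j, (d - Pi.single i t : Fin m → ℝ) j := by
    simpa [Finset.sum_sub_distrib] using ht
  refine absurd (hmin _ ⟨⟨hnonneg, hroot⟩, fun hmem => hdΓ ?_⟩) hheight
  rw [← hrefl, hyperplaneReflection_map, hyperplaneReflection_inv] at hmem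
  exact (Subgroup.mul_mem_cancel_left _ hsimple).1
    ((Subgroup.mul_mem_cancel_right _ hsimple).1 hmem)

theorem reflectionGroup_range (hΦ : IsRootSystem Φ) (hΔ : IsFundamentalSystem Φ Δ) :
    reflectionGroup (Set.range Δ) = reflectionGroup Φ := by
  refine le_antisymm (reflectionGroup_mono (Set.range_subset_iff.2 hΔ.mem)) ?_
  rw [reflectionGroup, Subgroup.closure_le]
  rintro _ ⟨β, hβ, rfl⟩
  obtain ⟨c, rfl, hc | hc⟩ := hΔ.nonneg_or_nonpos β hβ
  · exact hΔ.hyperplaneReflection_mem_of_nonneg hΦ hc hβ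
  · have hneg : -∑ i, c i • Δ i = ∑ i, (-c) i • Δ i := by
      simp only [Pi.neg_apply, neg_smul, Finset.sum_neg_distrib]
    rw [← hyperplaneReflection_neg, hneg]
    refine hΔ.hyperplaneReflection_mem_of_nonneg hΦ (neg_nonneg.2 hc) ?_
    rw [← hneg, ← neg_one_smul ℝ]
    exact (hΦ.smul_mem_iff _ hβ _).2 (Or.inr rfl)

end IsFundamentalSystem

/-! ### Signed permutations -/

section SignedPermutations

open SemidirectProduct

/-- The group of signed permutations of `ι` (the hyperoctahedral group). The pair `(ε, σ)` stands
for the linear map `e i ↦ ε (σ i) • e (σ i)` on the span of an orthonormal family `e`. -/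
abbrev SignedPerm (ι : Type*) := (ι → ℤˣ) ⋊[mulAutArrow] Equiv.Perm ι

namespace SignedPerm

variable {ι κ : Type*}

instance [Finite ι] : Finite (SignedPerm ι) :=
  Finite.of_equiv _ equivProd.symm

theorem mul_left_apply (g h : SignedPerm ι) (i : ι) :
    (g * h).left i = g.left i * h.left (g.right.symm i) :=
  rfl

theorem inr_mul_inl_mulSingle_mul_inr_inv [DecidableEq ι] (σ : Equiv.Perm ι) (i : ι) (u : ℤˣ) :
    (inr σ * inl (Pi.mulSingle i u) * (inr σ)⁻¹ : SignedPerm ι) = inl (Pi.mulSingle (σ i) u) := by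
  rw [← map_inv, ← inl_aut]
  congr 1
  ext j : 1
  change (Pi.mulSingle i u : ι → ℤˣ) (σ.symm j) = _
  simp only [Pi.mulSingle_apply, Equiv.symm_apply_eq]

section SignProd

variable [Fintype ι]

/-- The product of the signs of a signed permutation; its kernel is the Weyl group of type `D`. -/
def signProd : SignedPerm ι →* ℤˣ :=
  MonoidHom.mk' (fun g => ∏ i, g.left i) fun g h => by
    simp only [mul_left_apply, Finset.prod_mul_distrib]
    rw [Equiv.prod_comp g.right.symm h.left]

theorem signProd_inl (ε : ι → ℤˣ) : signProd (inl ε) = ∏ i, ε i :=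
  rfl

theorem signProd_inr (σ : Equiv.Perm ι) : signProd (inr σ) = 1 :=
  Finset.prod_eq_one fun _ _ => rfl

end SignProd

/-- The signed permutations that preserve the blocks (fibres) of the labelling `f` and change no
sign outside the block labelled `c`. -/
def blockSubgroup (f : ι → κ) (c : κ) : Subgroup (SignedPerm ι) where
  carrier := {g | (∀ i, f i ≠ c → g.left i = 1) ∧ f ∘ g.right = f}
  one_mem' := ⟨fun _ _ => rfl, rfl⟩
  mul_mem' {g h} hg hh := by
    refine ⟨fun i hi => ?_, ?_⟩
    · have hi' : f (g.right.symm i) = f i := by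
        rw [← congrFun hg.2, Function.comp_apply, Equiv.apply_symm_apply]
      rw [mul_left_apply, hg.1 i hi, hh.1 _ (hi'.trans_ne hi), mul_one]
    · rw [mul_right, Equiv.Perm.coe_mul, ← Function.comp_assoc, hg.2, hh.2]
  inv_mem' {g} hg := by
    refine ⟨fun i hi => ?_, ?_⟩
    · have hi' : f (g.right i) ≠ c := by rwa [← Function.comp_apply (f := f), hg.2]
      change (g.left (g.right i))⁻¹ = 1
      rw [hg.1 _ hi', inv_one]
    · rw [inv_right, ← hg.2, Function.comp_assoc]
      simp [hg.2]

theorem inr_mem_blockSubgroup {f : ι → κ} {c : κ} {σ : Equiv.Perm ι} :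
    inr σ ∈ blockSubgroup f c ↔ f ∘ σ = f :=
  ⟨fun h => h.2, fun h => ⟨fun _ _ => rfl, h⟩⟩

theorem inl_mulSingle_mem_blockSubgroup [DecidableEq ι] (f : ι → κ) (i : ι) (u : ℤˣ) :
    inl (Pi.mulSingle i u) ∈ blockSubgroup f (f i) :=
  ⟨fun j hj => Pi.mulSingle_eq_of_ne (M := fun _ => ℤˣ) (fun h : j = i => hj (congrArg f h)) u, rfl⟩

theorem comp_swap_eq_self [DecidableEq ι] {f : ι → κ} {i j : ι} (h : f i = f j) :
    f ∘ Equiv.swap i j = f := by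
  rw [Equiv.comp_swap_eq_update, h, Function.update_eq_self, ← h, Function.update_eq_self]

section Count

variable [Fintype ι] [Fintype κ] [DecidableEq κ]

theorem card_blockSubgroup (f : ι → κ) (c : κ) :
    Nat.card (blockSubgroup f c) =
      2 ^ Finset.card {i | f i = c} * ∏ j, (Finset.card {i | f i = j}).factorial := by
  classical
  let e : blockSubgroup f c ≃ {ε : ι → ℤˣ // ∀ i, f i ≠ c → ε i = 1} ×
      {σ : Equiv.Perm ι // f ∘ σ = f} :=
    (equivProd.subtypeEquiv fun _ => Iff.rfl).trans
      (Equiv.subtypeProdEquivProd (p := fun ε : ι → ℤˣ => ∀ i, f i ≠ c → ε i = 1)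
        (q := fun σ : Equiv.Perm ι => f ∘ σ = f))
  have hsigns : Nat.card {ε : ι → ℤˣ // ∀ i, f i ≠ c → ε i = 1} =
      2 ^ Finset.card {i | f i = c} := by
    have hcard (i : ι) : Nat.card {u : ℤˣ // f i ≠ c → u = 1} = if f i = c then 2 else 1 := by
      split_ifs with h <;> simp [h]
    rw [Nat.card_congr (Equiv.subtypePiEquivPi (p := fun i u => f i ≠ c → u = 1)), Nat.card_pi,
      Finset.prod_congr rfl fun i _ => hcard i, ← Finset.prod_filter, Finset.prod_const]
  rw [Nat.card_congr e, Nat.card_prod, hsigns, Nat.card_eq_fintype_card,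
    DomMulAct.stabilizer_card]
  simp only [Fintype.card_subtype]

theorem index_blockSubgroup (f : ι → κ) (c : κ) :
    (blockSubgroup f c).index = Nat.multinomial Finset.univ (fun j => Finset.card {i | f i = j}) *
      2 ^ Finset.card {i | f i ≠ c} := by
  have htotal : Nat.card (SignedPerm ι) = 2 ^ Fintype.card ι * (Fintype.card ι).factorial := by
    classical
    rw [SemidirectProduct.card, Nat.card_perm, Nat.card_eq_fintype_card, Nat.card_eq_fintype_card,
      Fintype.card_fun, Fintype.card_units_int]
  have hfibers : ∑ j, Finset.card {i | f i = j} = Fintype.card ι :=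
    (Finset.card_eq_sum_card_fiberwise fun i _ => Finset.mem_coe.2 (Finset.mem_univ (f i))).symm
  have hcompl : Finset.card {i | f i = c} + Finset.card {i | f i ≠ c} = Fintype.card ι :=
    Finset.card_filter_add_card_filter_not _
  refine Nat.eq_of_mul_eq_mul_left (Nat.card_pos (α := blockSubgroup f c)) ?_
  rw [Subgroup.card_mul_index, htotal, card_blockSubgroup, ← hcompl, pow_add, hcompl, ← hfibers,
    ← Nat.multinomial_spec]
  ring

end Count

section Generation

variable [DecidableEq ι] {f : ι → κ} {l : ι} {K : Subgroup (SignedPerm ι)}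

theorem blockSubgroup_le [Finite ι] (hperm : ∀ σ : Equiv.Perm ι, f ∘ σ = f → inr σ ∈ K)
    (hsign : inl (Pi.mulSingle l (-1)) ∈ K) : blockSubgroup f (f l) ≤ K := by
  have := Fintype.ofFinite ι
  intro g hg
  rw [← inl_left_mul_inr_right g]
  refine mul_mem ?_ (hperm _ hg.2)
  rw [← Finset.univ_prod_mulSingle g.left]
  refine prod_mem (S := K.comap inl) fun i _ => ?_
  by_cases hi : f i = f l
  · rcases Int.units_eq_one_or (g.left i) with h | h
    · rw [h, Pi.mulSingle_one]
      exact one_mem _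
    · have hswap := hperm _ (comp_swap_eq_self hi)
      rw [h, Subgroup.mem_comap, ← Equiv.swap_apply_right i l,
        ← inr_mul_inl_mulSingle_mul_inr_inv]
      exact mul_mem (mul_mem hswap hsign) (inv_mem hswap)
  · rw [hg.1 i hi, Pi.mulSingle_one]
    exact one_mem _

theorem blockSubgroup_inf_ker_signProd_le [Fintype ι] {p : ι}
    (hperm : ∀ σ : Equiv.Perm ι, f ∘ σ = f → inr σ ∈ K) (hpl : p ≠ l) (hf : f p = f l)
    (hsign : inl (Pi.mulSingle p (-1) * Pi.mulSingle l (-1)) ∈ K) :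
    blockSubgroup f (f l) ⊓ signProd.ker ≤ K := by
  rintro g ⟨hg, hgker⟩
  have hprod : ∏ i, g.left i = 1 := hgker
  have hdecomp : g.left = ∏ i, (Pi.mulSingle i (g.left i) * Pi.mulSingle l (g.left i)) := by
    have hl : ∏ i, (Pi.mulSingle l (g.left i) : ι → ℤˣ) = Pi.mulSingle l (∏ i, g.left i) :=
      (map_prod (MonoidHom.mulSingle (fun _ => ℤˣ) l) _ _).symm
    rw [Finset.prod_mul_distrib, Finset.univ_prod_mulSingle, hl, hprod, Pi.mulSingle_one, mul_one]
  rw [← inl_left_mul_inr_right g]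
  refine mul_mem ?_ (hperm _ hg.2)
  rw [hdecomp]
  refine prod_mem (S := K.comap inl) fun i _ => ?_
  rcases Int.units_eq_one_or (g.left i) with h | h
  · simp only [h, Pi.mulSingle_one, mul_one, one_mem]
  rw [h]
  by_cases hil : i = l
  · simp only [hil, ← Pi.mulSingle_mul, mul_neg, mul_one, neg_neg, Pi.mulSingle_one, one_mem]
  have hi : f i = f l := by
    by_contra hi
    exact absurd (hg.1 i hi) (by rw [h]; decide)
  have hswap := hperm _ (comp_swap_eq_self (hf.trans hi.symm))
  have hconj := mul_mem (mul_mem hswap hsign) (inv_mem hswap)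
  rwa [map_mul, ← conj_mul, inr_mul_inl_mulSingle_mul_inr_inv, inr_mul_inl_mulSingle_mul_inr_inv,
    Equiv.swap_apply_left, Equiv.swap_apply_of_ne_of_ne hpl.symm (Ne.symm hil), ← map_mul] at hconj

end Generation

end SignedPerm

end SignedPermutations

section AdjacentTranspositions

variable {κ : Type*} [PartialOrder κ] {m : ℕ} {f : Fin (m + 1) → κ}

theorem swap_mem_closure_adjacent_swaps (hf : Monotone f) {x y : Fin (m + 1)} (hxy : f x = f y) :
    Equiv.swap x y ∈ Subgroup.closure
      ((fun i : Fin m => Equiv.swap i.castSucc i.succ) '' {i | f i.castSucc = f i.succ}) := by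
  wlog hle : x ≤ y generalizing x y
  · rw [Equiv.swap_comm]
    exact this hxy.symm (le_of_not_ge hle)
  induction y using Fin.induction with
  | zero =>
    rw [Fin.le_zero_iff.1 hle, Equiv.swap_self]
    exact one_mem _
  | succ z ih =>
    rcases hle.eq_or_lt with rfl | hlt
    · rw [Equiv.swap_self]
      exact one_mem _
    have hxz : x ≤ z.castSucc := Fin.le_castSucc_iff.2 hlt
    have hzz : f z.castSucc ≤ f z.succ := hf z.castSucc_lt_succ.le
    have hfx : f x = f z.castSucc := (hf hxz).antisymm (hzz.trans_eq hxy.symm)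
    exact SubmonoidClass.swap_mem_trans _ (ih hfx hxz)
      (Subgroup.subset_closure ⟨z, hfx.symm.trans hxy, rfl⟩)

theorem mem_closure_adjacent_swaps (hf : Monotone f) {σ : Equiv.Perm (Fin (m + 1))}
    (hσ : f ∘ σ = f) :
    σ ∈ Subgroup.closure
      ((fun i : Fin m => Equiv.swap i.castSucc i.succ) '' {i | f i.castSucc = f i.succ}) := by
  have hswap : ∀ τ ∈ (fun i : Fin m => Equiv.swap i.castSucc i.succ) ''
      {i | f i.castSucc = f i.succ}, τ.IsSwap := by
    rintro _ ⟨i, -, rfl⟩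
    exact ⟨_, _, i.castSucc_lt_succ.ne, rfl⟩
  exact (mem_closure_isSwap hswap).2 ⟨Set.toFinite _, fun x =>
    (swap_mem_closure_isSwap hswap).1 (swap_mem_closure_adjacent_swaps hf (congrFun hσ x))⟩

end AdjacentTranspositions

theorem relIndex_eq_index_of_sup_eq_top {G : Type*} [Group G] {H N : Subgroup G} [N.Normal]
    [N.FiniteIndex] (h : H ⊔ N = ⊤) : H.relIndex N = H.index := by
  have hN : N.relIndex H = N.index := by
    rw [← Subgroup.relIndex_sup_right, h, Subgroup.relIndex_top_right]
  refine Nat.eq_of_mul_eq_mul_right (Nat.pos_of_ne_zero N.index_ne_zero_of_finite) ?_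
  rw [← Subgroup.inf_relIndex_right, Subgroup.relIndex_mul_index inf_le_right,
    ← Subgroup.relIndex_mul_index (inf_le_left : H ⊓ N ≤ H), Subgroup.inf_relIndex_left, hN,
    mul_comm]

/-- The nodes that do not separate two blocks of the labelling `f`; the last node separates
nothing. -/
def interiorNodes {κ : Type*} {m : ℕ} (f : Fin (m + 1) → κ) : Set (Fin (m + 1)) :=
  insert (Fin.last m) (Fin.castSucc '' {i | f i.castSucc = f i.succ})

namespace DynkinFamily

open SemidirectProduct SignedPerm

/-- The Weyl group of the given family as a group of signed permutations: all of them in types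
`B` and `C`, those with an even number of sign changes in type `D`. -/
def weylSubgroup {ι : Type*} [Fintype ι] : DynkinFamily → Subgroup (SignedPerm ι)
  | .B => ⊤
  | .C => ⊤
  | .D => signProd.ker

/-- The signed permutation given by the reflection in the last fundamental root: `e m ↦ -e m` in
types `B` and `C`, where the root is proportional to `e m`, and `e (m - 1) ↦ -e m`,
`e m ↦ -e (m - 1)` in type `D`, where it is proportional to `e (m - 1) + e m`. -/
def lastReflection : DynkinFamily → (m : ℕ) → SignedPerm (Fin (m + 2))
  | .B, m => inl (Pi.mulSingle (Fin.last (m + 1)) (-1))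
  | .C, m => inl (Pi.mulSingle (Fin.last (m + 1)) (-1))
  | .D, m => inl (Pi.mulSingle (Fin.last m).castSucc (-1) * Pi.mulSingle (Fin.last (m + 1)) (-1)) *
      inr (Equiv.swap (Fin.last m).castSucc (Fin.last (m + 1)))

/-- The signed permutations given by the reflections in the fundamental roots, which, except for
the last one, are proportional to `e i - e (i + 1)`. -/
def simpleReflection (X : DynkinFamily) (m : ℕ) : Fin (m + 2) → SignedPerm (Fin (m + 2)) :=
  Fin.snoc (fun i => inr (Equiv.swap i.castSucc i.succ)) (X.lastReflection m)

theorem simpleReflection_castSucc (X : DynkinFamily) (m : ℕ) (i : Fin (m + 1)) :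
    X.simpleReflection m i.castSucc = inr (Equiv.swap i.castSucc i.succ) :=
  Fin.snoc_castSucc (α := fun _ => SignedPerm (Fin (m + 2))) _ _ i

theorem simpleReflection_last (X : DynkinFamily) (m : ℕ) :
    X.simpleReflection m (Fin.last (m + 1)) = X.lastReflection m :=
  Fin.snoc_last (α := fun _ => SignedPerm (Fin (m + 2))) _ _

variable {κ : Type*} {m : ℕ}

theorem inr_mem_weylSubgroup {ι : Type*} [Fintype ι] (X : DynkinFamily) (σ : Equiv.Perm ι) :
    inr σ ∈ X.weylSubgroup := by
  cases X
  · exact Subgroup.mem_top _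
  · exact Subgroup.mem_top _
  · exact signProd_inr σ

theorem lastReflection_mem (X : DynkinFamily) {f : Fin (m + 2) → κ}
    (hf : f (Fin.last m).castSucc = f (Fin.last (m + 1))) :
    X.lastReflection m ∈ blockSubgroup f (f (Fin.last (m + 1))) ⊓ X.weylSubgroup := by
  cases X
  · exact ⟨inl_mulSingle_mem_blockSubgroup f _ _, Subgroup.mem_top _⟩
  · exact ⟨inl_mulSingle_mem_blockSubgroup f _ _, Subgroup.mem_top _⟩
  · rw [lastReflection, map_mul]
    refine ⟨mul_mem (mul_mem (hf ▸ inl_mulSingle_mem_blockSubgroup f _ _)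
      (inl_mulSingle_mem_blockSubgroup f _ _))
      (inr_mem_blockSubgroup.2 (comp_swap_eq_self hf)), ?_⟩
    simp [weylSubgroup, signProd_inl, signProd_inr]

theorem closure_simpleReflection [PartialOrder κ] (X : DynkinFamily) {f : Fin (m + 2) → κ}
    (hf : Monotone f) (hlast : f (Fin.last m).castSucc = f (Fin.last (m + 1))) :
    Subgroup.closure (X.simpleReflection m '' interiorNodes f) =
      blockSubgroup f (f (Fin.last (m + 1))) ⊓ X.weylSubgroup := by
  set K := Subgroup.closure (X.simpleReflection m '' interiorNodes f) with hK
  apply le_antisymm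
  · rw [hK, Subgroup.closure_le]
    rintro _ ⟨_, rfl | ⟨i, hi, rfl⟩, rfl⟩
    · rw [simpleReflection_last]
      exact X.lastReflection_mem hlast
    · rw [simpleReflection_castSucc]
      exact ⟨inr_mem_blockSubgroup.2 (comp_swap_eq_self hi), X.inr_mem_weylSubgroup _⟩
  · have hperm (σ : Equiv.Perm (Fin (m + 2))) (hσ : f ∘ σ = f) : inr σ ∈ K := by
      suffices h : Subgroup.closure ((fun i : Fin (m + 1) => Equiv.swap i.castSucc i.succ) ''
          {i | f i.castSucc = f i.succ}) ≤ K.comap inr from h (mem_closure_adjacent_swaps hf hσ)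
      rw [Subgroup.closure_le]
      rintro _ ⟨i, hi, rfl⟩
      exact Subgroup.subset_closure ⟨_, Or.inr ⟨i, hi, rfl⟩, X.simpleReflection_castSucc m i⟩
    have hmem : X.lastReflection m ∈ K :=
      Subgroup.subset_closure ⟨_, Set.mem_insert _ _, X.simpleReflection_last m⟩
    cases X
    · exact inf_le_left.trans (blockSubgroup_le hperm hmem)
    · exact inf_le_left.trans (blockSubgroup_le hperm hmem)
    · exact blockSubgroup_inf_ker_signProd_le hperm (Fin.castSucc_lt_last _).ne hlast
        ((Subgroup.mul_mem_cancel_right _ (hperm _ (comp_swap_eq_self hlast))).1 hmem)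

theorem relIndex_weylSubgroup {ι : Type*} [Fintype ι] (X : DynkinFamily) (f : ι → κ) (l : ι) :
    (blockSubgroup f (f l)).relIndex X.weylSubgroup = (blockSubgroup f (f l)).index := by
  classical
  cases X
  · exact Subgroup.relIndex_top_right _
  · exact Subgroup.relIndex_top_right _
  refine relIndex_eq_index_of_sup_eq_top (N := signProd.ker)
    ((Subgroup.eq_top_iff' _).2 fun g => ?_)
  have hsingle : inl (Pi.mulSingle l (signProd g)) ∈ blockSubgroup f (f l) :=
    inl_mulSingle_mem_blockSubgroup f l _
  have hker : g * (inl (Pi.mulSingle l (signProd g)))⁻¹ ∈ signProd.ker := by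
    rw [MonoidHom.mem_ker, map_mul, map_inv, signProd_inl, Finset.prod_pi_mulSingle',
      if_pos (Finset.mem_univ l), mul_inv_cancel]
  rw [← inv_mul_cancel_right g (inl (Pi.mulSingle l (signProd g)))]
  exact mul_mem (Subgroup.mem_sup_right hker) (Subgroup.mem_sup_left hsingle)

theorem closure_range_simpleReflection (X : DynkinFamily) (m : ℕ) :
    Subgroup.closure (Set.range (X.simpleReflection m)) = X.weylSubgroup := by
  have hconst : Monotone fun _ : Fin (m + 2) => () := monotone_const
  have huniv : interiorNodes (fun _ : Fin (m + 2) => ()) = Set.univ :=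
    Set.eq_univ_of_forall (Fin.lastCases (Or.inl rfl) fun i => Or.inr ⟨i, rfl, rfl⟩)
  have htop : blockSubgroup (fun _ : Fin (m + 2) => ()) () = ⊤ :=
    (Subgroup.eq_top_iff' _).2 fun _ => ⟨fun _ h => absurd rfl h, rfl⟩
  rw [← Set.image_univ, ← huniv, X.closure_simpleReflection hconst rfl, htop, top_inf_eq]

theorem relIndex_closure_simpleReflection [PartialOrder κ] (X : DynkinFamily)
    {f : Fin (m + 2) → κ} (hf : Monotone f)
    (hlast : f (Fin.last m).castSucc = f (Fin.last (m + 1))) :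
    (Subgroup.closure (X.simpleReflection m '' interiorNodes f)).relIndex
        (Subgroup.closure (Set.range (X.simpleReflection m))) =
      (blockSubgroup f (f (Fin.last (m + 1)))).index := by
  rw [closure_simpleReflection X hf hlast, closure_range_simpleReflection,
    Subgroup.inf_relIndex_right, relIndex_weylSubgroup]

end DynkinFamily

/-! ### The action of signed permutations on a Euclidean space -/

section Representation

open SemidirectProduct

variable {V : Type*} [NormedAddCommGroup V] [InnerProductSpace ℝ V] {ι : Type*} {e : ι → V}

theorem orthonormal_signed_comp (he : Orthonormal ℝ e) (g : SignedPerm ι) :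
    Orthonormal ℝ fun i => g.left (g.right i) • e (g.right i) := by
  refine ⟨fun i => by rw [norm_units_zsmul, he.1], fun i j hij => ?_⟩
  have horth := he.2 (g.right.injective.ne hij)
  rcases Int.units_eq_one_or (g.left (g.right i)) with hi | hi <;>
    rcases Int.units_eq_one_or (g.left (g.right j)) with hj | hj <;>
      simp [hi, hj, horth]

theorem inner_sub_sum_inner_smul_eq_zero [Fintype ι] (he : Orthonormal ℝ e) (v : V) (i : ι) :
    inner ℝ (e i) (v - ∑ j, inner ℝ (e j) v • e j) = 0 := by
  rw [inner_sub_right, he.inner_right_fintype, sub_self]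

theorem linearMap_ext_of_orthonormal [Finite ι] {M : Type*} [AddCommGroup M] [Module ℝ M]
    (he : Orthonormal ℝ e) {S T : V →ₗ[ℝ] M} (hmem : ∀ i, S (e i) = T (e i))
    (horth : ∀ w, (∀ i, inner ℝ (e i) w = 0) → S w = T w) : S = T := by
  have := Fintype.ofFinite ι
  ext v
  have h := horth _ (inner_sub_sum_inner_smul_eq_zero he v)
  simpa only [map_sub, map_sum, map_smul, hmem, sub_left_inj] using h

variable [Fintype ι]

theorem norm_sq_sum_smul_add (he : Orthonormal ℝ e) (a : ι → ℝ) {w : V}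
    (hw : ∀ i, inner ℝ (e i) w = 0) : ‖∑ i, a i • e i + w‖ ^ 2 = ∑ i, a i ^ 2 + ‖w‖ ^ 2 := by
  have hsum : inner ℝ (∑ i, a i • e i) w = 0 := by
    simp only [sum_inner, real_inner_smul_left, hw, mul_zero, Finset.sum_const_zero]
  rw [norm_add_sq_real, hsum, mul_zero, add_zero, ← real_inner_self_eq_norm_sq,
    he.inner_sum]
  simp [sq]

/-- The linear map by which a signed permutation acts on `V`: it permutes the vectors `± e i` and
fixes the orthogonal complement of `e`. -/
noncomputable def signedPermLinearMap (e : ι → V) (g : SignedPerm ι) : V →ₗ[ℝ] V :=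
  LinearMap.id + ∑ i, (innerₛₗ ℝ (e i)).smulRight (g.left (g.right i) • e (g.right i) - e i)

theorem signedPermLinearMap_apply (g : SignedPerm ι) (v : V) :
    signedPermLinearMap e g v =
      v + ∑ i, inner ℝ (e i) v • (g.left (g.right i) • e (g.right i) - e i) := by
  simp [signedPermLinearMap]

theorem signedPermLinearMap_apply_of_orthogonal (g : SignedPerm ι) {w : V}
    (hw : ∀ i, inner ℝ (e i) w = 0) : signedPermLinearMap e g w = w := by
  simp only [signedPermLinearMap_apply, hw, zero_smul, Finset.sum_const_zero, add_zero]

theorem signedPermLinearMap_apply_self (he : Orthonormal ℝ e) (g : SignedPerm ι) (i : ι) :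
    signedPermLinearMap e g (e i) = g.left (g.right i) • e (g.right i) := by
  classical
  simp [signedPermLinearMap_apply, orthonormal_iff_ite.1 he, ite_smul]

theorem norm_signedPermLinearMap (he : Orthonormal ℝ e) (g : SignedPerm ι) (v : V) :
    ‖signedPermLinearMap e g v‖ = ‖v‖ := by
  set w := v - ∑ i, inner ℝ (e i) v • e i with hw
  have horth : ∀ i, inner ℝ (e i) w = 0 := inner_sub_sum_inner_smul_eq_zero he v
  have hv : v = ∑ i, inner ℝ (e i) v • e i + w := (add_sub_cancel _ _).symm
  have hgv : signedPermLinearMap e g v =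
      ∑ i, inner ℝ (e i) v • g.left (g.right i) • e (g.right i) + w := by
    rw [signedPermLinearMap_apply, hw]
    simp only [smul_sub, Finset.sum_sub_distrib]
    abel
  have horth' (i : ι) : inner ℝ (g.left (g.right i) • e (g.right i)) w = 0 := by
    rw [Units.smul_def, ← Int.cast_smul_eq_zsmul ℝ, real_inner_smul_left, horth, mul_zero]
  rw [← sq_eq_sq₀ (norm_nonneg _) (norm_nonneg _), hgv,
    norm_sq_sum_smul_add (orthonormal_signed_comp he g) _ horth', ← norm_sq_sum_smul_add he _ horth,
    ← hv]

theorem signedPermLinearMap_mul (he : Orthonormal ℝ e) (g h : SignedPerm ι) :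
    signedPermLinearMap e (g * h) = signedPermLinearMap e g * signedPermLinearMap e h := by
  refine linearMap_ext_of_orthonormal he (fun i => ?_) fun w hw => ?_
  · rw [Module.End.mul_apply]
    simp only [signedPermLinearMap_apply_self he, Units.smul_def, map_zsmul,
      SignedPerm.mul_left_apply, mul_right, Equiv.Perm.mul_apply, Equiv.symm_apply_apply]
    rw [Units.val_mul, mul_comm, mul_smul]
  · rw [Module.End.mul_apply]
    simp only [signedPermLinearMap_apply_of_orthogonal _ hw]

theorem signedPermLinearMap_one (e : ι → V) : signedPermLinearMap e 1 = 1 := by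
  ext v
  simp [signedPermLinearMap_apply]

/-- The action of signed permutations on `V` by isometries that permute the vectors `± e i` of an
orthonormal family and fix its orthogonal complement. -/
noncomputable def signedPermHom (he : Orthonormal ℝ e) : SignedPerm ι →* (V ≃ₗᵢ[ℝ] V) where
  toFun g :=
    { toLinearEquiv := LinearEquiv.ofLinearMap (signedPermLinearMap e g) (signedPermLinearMap e g⁻¹)
        (by rw [← Module.End.mul_eq_comp, ← signedPermLinearMap_mul he, mul_inv_cancel,
          signedPermLinearMap_one]; rfl)
        (by rw [← Module.End.mul_eq_comp, ← signedPermLinearMap_mul he, inv_mul_cancel,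
          signedPermLinearMap_one]; rfl)
      norm_map' := norm_signedPermLinearMap he g }
  map_one' := LinearIsometryEquiv.ext fun v => by
    exact congrArg (· v) (signedPermLinearMap_one e)
  map_mul' g h := LinearIsometryEquiv.ext fun v => by
    exact congrArg (· v) (signedPermLinearMap_mul he g h)

theorem signedPermHom_apply (he : Orthonormal ℝ e) (g : SignedPerm ι) (v : V) :
    signedPermHom he g v = signedPermLinearMap e g v :=
  rfl

theorem eq_signedPermHom (he : Orthonormal ℝ e) {g : SignedPerm ι} {T : V ≃ₗᵢ[ℝ] V}
    (hmem : ∀ i, T (e i) = g.left (g.right i) • e (g.right i))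
    (horth : ∀ w, (∀ i, inner ℝ (e i) w = 0) → T w = w) : T = signedPermHom he g := by
  have h : (T.toLinearEquiv : V →ₗ[ℝ] V) = signedPermLinearMap e g :=
    linearMap_ext_of_orthonormal he
      (fun i => (hmem i).trans (signedPermLinearMap_apply_self he g i).symm)
      fun w hw => (horth w hw).trans (signedPermLinearMap_apply_of_orthogonal g hw).symm
  exact LinearIsometryEquiv.ext fun v => congrArg (· v) h

theorem signedPermHom_injective (he : Orthonormal ℝ e) :
    Function.Injective (signedPermHom he) := by
  classical
  refine (injective_iff_map_eq_one _).2 fun g hg => ?_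
  have hfix (i : ι) : g.left (g.right i) • e (g.right i) = e i := by
    rw [← signedPermLinearMap_apply_self he, ← signedPermHom_apply he, hg]
    rfl
  have hinner (i : ι) : (g.left (g.right i) : ℝ) * inner ℝ (e i) (e (g.right i)) = 1 := by
    rw [← real_inner_smul_right, Int.cast_smul_eq_zsmul, ← Units.smul_def, hfix,
      real_inner_self_eq_norm_sq, he.1, one_pow]
  have hright (i : ι) : g.right i = i := by
    by_contra h
    exact zero_ne_one ((mul_eq_zero_of_right _ (he.2 (Ne.symm h))).symm.trans (hinner i))
  have hleft (i : ι) : g.left i = 1 := by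
    have h := hinner i
    rw [hright, real_inner_self_eq_norm_sq, he.1, one_pow, mul_one] at h
    exact Units.ext (Int.cast_eq_one.1 h)
  exact SemidirectProduct.ext (funext hleft) (Equiv.ext hright)

variable [DecidableEq ι]

theorem hyperplaneReflection_self_eq_signedPermHom (he : Orthonormal ℝ e) (i : ι) :
    hyperplaneReflection (e i) = signedPermHom he (inl (Pi.mulSingle i (-1))) := by
  refine eq_signedPermHom he (fun j => ?_) fun w hw => ?_
  · rw [hyperplaneReflection_apply]
    change _ = (Pi.mulSingle i (-1) : ι → ℤˣ) j • e j
    rcases eq_or_ne j i with rfl | hj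
    · simp [he.1, two_smul]
    · simp [he.2 hj.symm, hj]
  · rw [hyperplaneReflection_apply, hw, mul_zero, zero_div, zero_smul, sub_zero]

theorem hyperplaneReflection_sub_eq_signedPermHom (he : Orthonormal ℝ e) {i j : ι} (hij : i ≠ j) :
    hyperplaneReflection (e i - e j) = signedPermHom he (inr (Equiv.swap i j)) := by
  have hnorm : inner ℝ (e i - e j) (e i - e j) = 2 := by
    simp only [inner_sub_left, inner_sub_right, orthonormal_iff_ite.1 he, hij, hij.symm, if_true,
      if_false]
    norm_num
  refine eq_signedPermHom he (fun l => ?_) fun w hw => ?_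
  · rw [hyperplaneReflection_apply, hnorm, mul_div_cancel_left₀ _ two_ne_zero, inner_sub_left]
    change _ = (1 : ℤˣ) • e (Equiv.swap i j l)
    rw [one_smul]
    rcases eq_or_ne l i with rfl | hli
    · simp [he.1, he.2 hij.symm]
    rcases eq_or_ne l j with rfl | hlj
    · simp [he.1, he.2 hij]
    · simp [he.2 hli.symm, he.2 hlj.symm, Equiv.swap_apply_of_ne_of_ne hli hlj]
  · rw [hyperplaneReflection_apply, inner_sub_left, hw, hw, sub_zero, mul_zero, zero_div,
      zero_smul, sub_zero]

theorem hyperplaneReflection_add_eq_signedPermHom (he : Orthonormal ℝ e) {i j : ι} (hij : i ≠ j) :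
    hyperplaneReflection (e i + e j) = signedPermHom he
      (inl (Pi.mulSingle i (-1) * Pi.mulSingle j (-1)) * inr (Equiv.swap i j)) := by
  have hflip : e i + e j = hyperplaneReflection (e j) (e i - e j) := by
    rw [hyperplaneReflection_apply, inner_sub_right, real_inner_self_eq_norm_sq, he.1,
      he.2 hij.symm]
    module
  have hconj := SignedPerm.inr_mul_inl_mulSingle_mul_inr_inv (Equiv.swap i j) j (-1)
  rw [mul_inv_eq_iff_eq_mul, Equiv.swap_apply_right] at hconj
  rw [hflip, hyperplaneReflection_map, hyperplaneReflection_inv,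
    hyperplaneReflection_self_eq_signedPermHom he, hyperplaneReflection_sub_eq_signedPermHom he hij,
    ← map_mul, ← map_mul, mul_assoc, hconj, ← mul_assoc, ← map_mul, mul_comm (Pi.mulSingle j _)]

end Representation

/-! ### Fundamental systems with a given Dynkin diagram -/

section StandardRoots

variable {V : Type*} [AddCommGroup V] [Module ℝ V] {m : ℕ}

/-- The last fundamental root of the given family in the standard model: `e m`, `2 e m` and
`e (m - 1) + e m` in types `B`, `C` and `D`. -/
def DynkinFamily.lastStandardRoot : DynkinFamily → (Fin (m + 2) → V) → V
  | .B, e => e (Fin.last (m + 1))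
  | .C, e => (2 : ℝ) • e (Fin.last (m + 1))
  | .D, e => e (Fin.last m).castSucc + e (Fin.last (m + 1))

/-- The fundamental roots of the given family in the standard model: `e i - e (i + 1)`, followed by
`lastStandardRoot`. -/
def DynkinFamily.standardRoot (X : DynkinFamily) (e : Fin (m + 2) → V) : Fin (m + 2) → V :=
  Fin.snoc (fun i => e i.castSucc - e i.succ) (X.lastStandardRoot e)

theorem DynkinFamily.standardRoot_castSucc (X : DynkinFamily) (e : Fin (m + 2) → V)
    (i : Fin (m + 1)) : X.standardRoot e i.castSucc = e i.castSucc - e i.succ :=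
  Fin.snoc_castSucc (α := fun _ => V) _ _ i

theorem DynkinFamily.standardRoot_last (X : DynkinFamily) (e : Fin (m + 2) → V) :
    X.standardRoot e (Fin.last (m + 1)) = X.lastStandardRoot e :=
  Fin.snoc_last (α := fun _ => V) _ _

theorem DynkinFamily.map_standardRoot (X : DynkinFamily) {M : Type*} [AddCommGroup M] [Module ℝ M]
    (T : V →ₗ[ℝ] M) (e : Fin (m + 2) → V) (i : Fin (m + 2)) :
    T (X.standardRoot e i) = X.standardRoot (T ∘ e) i := by
  cases i using Fin.lastCases with
  | last => cases X <;> simp [standardRoot_last, lastStandardRoot]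
  | cast i => simp [standardRoot_castSucc]

theorem DynkinFamily.mem_span_standardRoot (X : DynkinFamily) (e : Fin (m + 2) → V)
    (i : Fin (m + 2)) : e i ∈ Submodule.span ℝ (Set.range (X.standardRoot e)) := by
  have hmem (i) : X.standardRoot e i ∈ Submodule.span ℝ (Set.range (X.standardRoot e)) :=
    Submodule.subset_span (Set.mem_range_self i)
  induction i using Fin.reverseInduction with
  | last =>
    have hlast := hmem (Fin.last (m + 1))
    rw [standardRoot_last] at hlast
    cases X with
    | B => exact hlast
    | C => exact (Submodule.smul_mem_iff _ two_ne_zero).1 hlast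
    | D =>
      have hpenultimate := hmem (Fin.last m).castSucc
      rw [standardRoot_castSucc, Fin.succ_last] at hpenultimate
      refine (Submodule.smul_mem_iff _ (two_ne_zero (α := ℝ))).1 ?_
      convert sub_mem hlast hpenultimate using 1
      simp only [lastStandardRoot]
      module
  | cast i ih =>
    rw [← sub_add_cancel (e i.castSucc) (e i.succ), ← X.standardRoot_castSucc]
    exact add_mem (hmem _) ih

end StandardRoots

section DynkinDiagram

variable {V : Type*} [NormedAddCommGroup V] [InnerProductSpace ℝ V] {m : ℕ}

theorem DynkinFamily.cartanMatrix_castSucc_castSucc (X : DynkinFamily) (i j : Fin (m + 1)) :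
    X.cartanMatrix (m + 2) i.castSucc j.castSucc = CartanMatrix.A (m + 1) i j := by
  cases X <;>
    simp only [cartanMatrix, CartanMatrix.A, CartanMatrix.B, CartanMatrix.C, CartanMatrix.D,
      Matrix.of_apply, Fin.ext_iff, Fin.val_castSucc] <;>
    split_ifs <;> omega

theorem inner_sub_succ_sub_succ {e : Fin (m + 2) → V} (he : Orthonormal ℝ e) (i j : Fin (m + 1)) :
    inner ℝ (e i.castSucc - e i.succ) (e j.castSucc - e j.succ) = CartanMatrix.A (m + 1) i j := by
  simp only [inner_sub_left, inner_sub_right, orthonormal_iff_ite.1 he, CartanMatrix.A,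
    Matrix.of_apply, Fin.ext_iff, Fin.val_castSucc, Fin.val_succ]
  split_ifs <;> first | omega | norm_num

theorem DynkinFamily.inner_lastStandardRoot_self (X : DynkinFamily) {e : Fin (m + 2) → V}
    (he : Orthonormal ℝ e) : inner ℝ (X.lastStandardRoot e) (X.lastStandardRoot e) =
      match X with | .B => 1 | .C => 4 | .D => 2 := by
  cases X <;>
    simp only [lastStandardRoot, inner_add_left, inner_add_right, real_inner_smul_left,
      real_inner_smul_right, orthonormal_iff_ite.1 he, Fin.ext_iff, Fin.val_castSucc,
      Fin.val_last, m.succ_ne_self, m.succ_ne_self.symm, if_true, if_false] <;>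
    norm_num

theorem DynkinFamily.inner_sub_succ_lastStandardRoot (X : DynkinFamily) {e : Fin (m + 2) → V}
    (he : Orthonormal ℝ e) (i : Fin (m + 1)) :
    inner ℝ (e i.castSucc - e i.succ) (X.lastStandardRoot e) =
      match X with
      | .B => if (i : ℕ) = m then -1 else 0
      | .C => if (i : ℕ) = m then -2 else 0
      | .D => if (i : ℕ) + 1 = m then -1 else 0 := by
  cases X <;>
    simp only [lastStandardRoot, inner_sub_left, inner_add_right, real_inner_smul_right,
      orthonormal_iff_ite.1 he, Fin.ext_iff, Fin.val_castSucc, Fin.val_succ, Fin.val_last] <;>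
    split_ifs <;> first | omega | norm_num

theorem DynkinFamily.hasDynkinDiagram_standardRoot (X : DynkinFamily) (hm : 1 ≤ m)
    {e : Fin (m + 2) → V} (he : Orthonormal ℝ e) : HasDynkinDiagram X (X.standardRoot e) := by
  have hm2 : ¬ m + 2 ≤ 2 := by omega
  have hself (i : Fin (m + 1)) : CartanMatrix.A (m + 1) i i = 2 := if_pos rfl
  refine Fin.lastCases (Fin.lastCases ?_ fun j => ?_) fun i => Fin.lastCases ?_ fun j => ?_ <;>
    simp only [standardRoot_castSucc, standardRoot_last, inner_sub_succ_sub_succ he, hself,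
      cartanMatrix_castSucc_castSucc, inner_lastStandardRoot_self _ he,
      inner_sub_succ_lastStandardRoot _ he, real_inner_comm (_ - _) (X.lastStandardRoot e)]
  · cases X <;> simp [cartanMatrix]
  · cases X <;>
      simp only [cartanMatrix, CartanMatrix.B, CartanMatrix.C, CartanMatrix.D, Matrix.of_apply,
        Fin.ext_iff, Fin.val_castSucc, Fin.val_last, or_true, and_true, if_neg hm2] <;>
      split_ifs <;> first | omega | norm_num
  · cases X <;>
      simp only [cartanMatrix, CartanMatrix.B, CartanMatrix.C, CartanMatrix.D, Matrix.of_apply,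
        Fin.ext_iff, Fin.val_castSucc, Fin.val_last, or_true, and_true, if_neg hm2] <;>
      split_ifs <;> first | omega | norm_num
  · norm_num

theorem DynkinFamily.exists_lt_cartanMatrix_ne_zero (X : DynkinFamily) (hm : 2 ≤ m) (j : Fin m) :
    ∃ i < j.succ, X.cartanMatrix (m + 1) i j.succ ≠ 0 := by
  have hadj : (X = .D → (j : ℕ) + 1 < m) → X.cartanMatrix (m + 1) j.castSucc j.succ ≠ 0 := by
    cases X <;>
      simp only [cartanMatrix, CartanMatrix.B, CartanMatrix.C, CartanMatrix.D, Matrix.of_apply,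
        Fin.ext_iff, Fin.val_castSucc, Fin.val_succ] <;>
      split_ifs <;> grind
  rcases em (X = .D → (j : ℕ) + 1 < m) with hj | hj
  · exact ⟨_, j.castSucc_lt_succ, hadj hj⟩
  · obtain ⟨rfl, hj⟩ := Classical.not_imp.1 hj
    refine ⟨⟨m - 2, by omega⟩, Fin.lt_def.2 (by simp only [Fin.val_succ]; omega), ?_⟩
    simp only [cartanMatrix, CartanMatrix.D, Matrix.of_apply, Fin.ext_iff, Fin.val_succ]
    split_ifs <;> omega

variable {V' : Type*} [NormedAddCommGroup V'] [InnerProductSpace ℝ V'] {X : DynkinFamily}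

namespace HasDynkinDiagram

theorem two_mul_inner {Δ : Fin m → V} (hX : HasDynkinDiagram X Δ) (h0 : ∀ i, Δ i ≠ 0)
    (i j : Fin m) :
    2 * inner ℝ (Δ i) (Δ j) = (X.cartanMatrix m i j : ℝ) * inner ℝ (Δ j) (Δ j) :=
  (div_eq_iff (real_inner_self_pos.2 (h0 j)).ne').1 (hX i j)

theorem cartanMatrix_mul_inner_self {Δ : Fin m → V} (hX : HasDynkinDiagram X Δ)
    (h0 : ∀ i, Δ i ≠ 0) (i j : Fin m) :
    (X.cartanMatrix m i j : ℝ) * inner ℝ (Δ j) (Δ j) =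
      X.cartanMatrix m j i * inner ℝ (Δ i) (Δ i) := by
  rw [← hX.two_mul_inner h0, ← hX.two_mul_inner h0, real_inner_comm]

theorem exists_inner_eq_mul_inner {Δ : Fin (m + 1) → V} {Δ' : Fin (m + 1) → V'}
    (hX : HasDynkinDiagram X Δ) (h0 : ∀ i, Δ i ≠ 0) (hX' : HasDynkinDiagram X Δ')
    (h0' : ∀ i, Δ' i ≠ 0) (hm : 2 ≤ m) :
    ∃ t > 0, ∀ i j, inner ℝ (Δ i) (Δ j) = t * inner ℝ (Δ' i) (Δ' j) := by
  have hpos (i) : 0 < inner ℝ (Δ i) (Δ i) := real_inner_self_pos.2 (h0 i)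
  have hpos' (i) : 0 < inner ℝ (Δ' i) (Δ' i) := real_inner_self_pos.2 (h0' i)
  set t := inner ℝ (Δ 0) (Δ 0) / inner ℝ (Δ' 0) (Δ' 0) with ht
  have hself (i) : inner ℝ (Δ i) (Δ i) = t * inner ℝ (Δ' i) (Δ' i) := by
    induction i using WellFoundedLT.induction with
    | ind i ih =>
      cases i using Fin.cases with
      | zero => rw [ht, div_mul_cancel₀ _ (hpos' 0).ne']
      | succ j =>
        obtain ⟨i, hij, hA⟩ := X.exists_lt_cartanMatrix_ne_zero hm j
        refine mul_left_cancel₀ (Int.cast_ne_zero.2 hA : (_ : ℝ) ≠ 0) ?_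
        rw [hX.cartanMatrix_mul_inner_self h0, ih i hij, mul_left_comm,
          ← hX'.cartanMatrix_mul_inner_self h0', mul_left_comm]
  refine ⟨t, div_pos (hpos 0) (hpos' 0), fun i j => mul_left_cancel₀ (two_ne_zero (α := ℝ)) ?_⟩
  rw [hX.two_mul_inner h0, hself, mul_left_comm, ← hX'.two_mul_inner h0', mul_left_comm]

end HasDynkinDiagram

theorem exists_linearIsometry_of_inner_eq {ι : Type*} (b : Module.Basis ι ℝ V') {v : ι → V}
    (h : ∀ i j, inner ℝ (v i) (v j) = inner ℝ (b i) (b j)) :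
    ∃ T : V' →ₗᵢ[ℝ] V, ∀ i, T (b i) = v i := by
  have hinner : (innerₗ V).compl₁₂ (b.constr ℝ v) (b.constr ℝ v) = innerₗ V' :=
    LinearMap.ext_basis b b fun i j => by simpa using h i j
  exact ⟨(b.constr ℝ v).isometryOfInner fun x y => LinearMap.congr_fun₂ hinner x y,
    b.constr_basis ℝ v⟩

theorem HasDynkinDiagram.exists_orthonormal_eq_smul_standardRoot {Δ : Fin (m + 2) → V}
    (hX : HasDynkinDiagram X Δ) (h0 : ∀ i, Δ i ≠ 0) (hm : 1 ≤ m) :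
    ∃ e : Fin (m + 2) → V, Orthonormal ℝ e ∧ ∃ c : ℝ, c ≠ 0 ∧
      ∀ i, Δ i = c • X.standardRoot e i := by
  let u := EuclideanSpace.basisFun (Fin (m + 2)) ℝ
  have hspan : ⊤ ≤ Submodule.span ℝ (Set.range (X.standardRoot u)) := by
    rw [← u.toBasis.span_eq, Submodule.span_le, u.coe_toBasis]
    exact Set.range_subset_iff.2 (X.mem_span_standardRoot u)
  let b := basisOfTopLeSpanOfCardEqFinrank (X.standardRoot u) hspan (by simp)
  have hb : ⇑b = X.standardRoot u := coe_basisOfTopLeSpanOfCardEqFinrank _ _ _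
  obtain ⟨t, ht, hinner⟩ := hX.exists_inner_eq_mul_inner h0
    (X.hasDynkinDiagram_standardRoot hm u.orthonormal) (fun i => hb ▸ b.ne_zero i) (by omega)
  have hc : √t ≠ 0 := (Real.sqrt_pos.2 ht).ne'
  obtain ⟨T, hT⟩ := exists_linearIsometry_of_inner_eq b (v := (√t)⁻¹ • Δ) fun i j => by
    rw [Pi.smul_apply, Pi.smul_apply, real_inner_smul_left, real_inner_smul_right, hinner, hb,
      inv_mul_eq_iff_eq_mul₀ hc, inv_mul_eq_iff_eq_mul₀ hc, ← mul_assoc, Real.mul_self_sqrt ht.le]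
  refine ⟨T ∘ u, u.orthonormal.comp_linearIsometry T, √t, hc, fun i => ?_⟩
  rw [← inv_smul_eq_iff₀ hc, ← Pi.smul_apply, ← hT, hb]
  exact X.map_standardRoot T.toLinearMap u i

theorem DynkinFamily.hyperplaneReflection_standardRoot (X : DynkinFamily) {e : Fin (m + 2) → V}
    (he : Orthonormal ℝ e) (i : Fin (m + 2)) :
    hyperplaneReflection (X.standardRoot e i) = signedPermHom he (X.simpleReflection m i) := by
  cases i using Fin.lastCases with
  | cast i =>
    rw [standardRoot_castSucc, simpleReflection_castSucc,
      hyperplaneReflection_sub_eq_signedPermHom he i.castSucc_lt_succ.ne]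
  | last =>
    rw [standardRoot_last, simpleReflection_last]
    cases X with
    | B => exact hyperplaneReflection_self_eq_signedPermHom he _
    | C =>
      rw [lastStandardRoot, hyperplaneReflection_smul two_ne_zero]
      exact hyperplaneReflection_self_eq_signedPermHom he _
    | D => exact hyperplaneReflection_add_eq_signedPermHom he (Fin.castSucc_lt_last _).ne

theorem HasDynkinDiagram.relIndex_reflectionGroup {κ : Type*} [PartialOrder κ]
    {Δ : Fin (m + 2) → V} (hX : HasDynkinDiagram X Δ) (h0 : ∀ i, Δ i ≠ 0) (hm : 1 ≤ m)
    {f : Fin (m + 2) → κ} (hf : Monotone f)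
    (hlast : f (Fin.last m).castSucc = f (Fin.last (m + 1))) :
    (reflectionGroup (Δ '' interiorNodes f)).relIndex (reflectionGroup (Set.range Δ)) =
      (SignedPerm.blockSubgroup f (f (Fin.last (m + 1)))).index := by
  obtain ⟨e, he, c, hc, hΔ⟩ := hX.exists_orthonormal_eq_smul_standardRoot h0 hm
  have hgroup (S : Set (Fin (m + 2))) : reflectionGroup (Δ '' S) =
      (Subgroup.closure (X.simpleReflection m '' S)).map (signedPermHom he) := by
    rw [reflectionGroup, MonoidHom.map_closure, Set.image_image, Set.image_image]
    congr! 2 with i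
    rw [hΔ, hyperplaneReflection_smul hc, X.hyperplaneReflection_standardRoot he]
  rw [← Set.image_univ, hgroup, hgroup,
    Subgroup.relIndex_map_map_of_injective _ _ (signedPermHom_injective he), Set.image_univ,
    X.relIndex_closure_simpleReflection hf hlast]

end DynkinDiagram

/-! ### Labellings by consecutive blocks -/

section BlockLabelling

variable {κ : Type*} [LinearOrder κ] [LocallyFiniteOrderBot κ] {b : κ → ℕ} {m : ℕ}

/-- `f` labels the integers `0, …, m - 1` by consecutive blocks, the block with label `j` having
size `b j`, except that the last blocks may be truncated. -/
def IsBlockLabelling (b : κ → ℕ) (f : Fin m → κ) : Prop :=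
  ∀ i j, f i ≤ j ↔ (i : ℕ) < ∑ a ∈ Finset.Iic j, b a

theorem exists_isBlockLabelling [Fintype κ] [OrderTop κ] (hm : m ≤ ∑ j, b j) :
    ∃ f : Fin m → κ, IsBlockLabelling b f := by
  have hleast (i : Fin m) : ∃ l, ∀ j, l ≤ j ↔ (i : ℕ) < ∑ a ∈ Finset.Iic j, b a := by
    obtain ⟨l, hl, hmin⟩ := Set.exists_min_image {j | (i : ℕ) < ∑ a ∈ Finset.Iic j, b a} id
      (Set.toFinite _) ⟨⊤, by rw [Set.mem_ofPred_eq, Finset.Iic_top]; exact i.2.trans_le hm⟩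
    exact ⟨l, fun j => ⟨fun h => lt_of_lt_of_le hl
      (Finset.sum_le_sum_of_subset (Finset.Iic_subset_Iic.2 h)), hmin j⟩⟩
  choose f hf using hleast
  exact ⟨f, hf⟩

namespace IsBlockLabelling

theorem lt_iff {f : Fin m → κ} (hf : IsBlockLabelling b f) (i : Fin m) (j : κ) :
    f i < j ↔ (i : ℕ) < ∑ a ∈ Finset.Iio j, b a := by
  constructor
  · intro h
    exact ((hf i _).1 le_rfl).trans_le
      (Finset.sum_le_sum_of_subset fun _ ha =>
        Finset.mem_Iio.2 ((Finset.mem_Iic.1 ha).trans_lt h))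
  · intro h
    obtain ⟨l, hl, hmax⟩ := Finset.exists_max_image (Finset.Iio j) id
      (Finset.nonempty_of_sum_ne_zero (Nat.ne_zero_of_lt h))
    have hsub : Finset.Iio j ⊆ Finset.Iic l := fun a ha => Finset.mem_Iic.2 (hmax a ha)
    exact ((hf i l).2 (h.trans_le (Finset.sum_le_sum_of_subset hsub))).trans_lt
      (Finset.mem_Iio.1 hl)

theorem monotone {f : Fin m → κ} (hf : IsBlockLabelling b f) : Monotone f := fun i j hij =>
  (hf i _).2 (lt_of_le_of_lt hij ((hf j _).1 le_rfl))

theorem eq_top_iff [OrderTop κ] {f : Fin m → κ} (hf : IsBlockLabelling b f) (i : Fin m) :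
    f i = ⊤ ↔ ∑ a ∈ Finset.Iio ⊤, b a ≤ i := by
  rw [← not_lt_top_iff, hf.lt_iff, not_lt]

theorem card_fiber [Fintype κ] {f : Fin m → κ} (hf : IsBlockLabelling b f) (hm : m = ∑ j, b j)
    (j : κ) : Finset.card {i | f i = j} = b j := by
  have hle : ∑ a ∈ Finset.Iic j, b a ≤ m :=
    hm ▸ Finset.sum_le_sum_of_subset (Finset.subset_univ _)
  have hfiber (i : Fin m) :
      f i = j ↔ ∑ a ∈ Finset.Iio j, b a ≤ i ∧ (i : ℕ) < ∑ a ∈ Finset.Iic j, b a := by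
    rw [eq_iff_le_not_lt, hf, hf.lt_iff, not_lt, and_comm]
  have hmap : Finset.map Fin.valEmbedding {i | f i = j} =
      Finset.Ico (∑ a ∈ Finset.Iio j, b a) (∑ a ∈ Finset.Iic j, b a) := by
    ext x
    simp only [Finset.mem_map, Finset.mem_filter, Finset.mem_univ, true_and, Finset.mem_Ico,
      Fin.valEmbedding_apply, hfiber]
    exact ⟨fun ⟨_, hi, hx⟩ => hx ▸ hi, fun h => ⟨⟨x, h.2.trans_le hle⟩, h, rfl⟩⟩
  rw [← Finset.card_map Fin.valEmbedding, hmap, Nat.card_Ico, Finset.Iic_eq_cons_Iio,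
    Finset.sum_cons, Nat.add_sub_cancel]

theorem castSucc_ne_succ_iff {f : Fin (m + 1) → κ} (hf : IsBlockLabelling b f) (i : Fin m) :
    f i.castSucc ≠ f i.succ ↔ ∃ j, (i : ℕ) + 1 = ∑ a ∈ Finset.Iic j, b a := by
  constructor
  · intro hne
    have hlt : f i.castSucc < f i.succ := (hf.monotone i.castSucc_lt_succ.le).lt_of_ne hne
    exact ⟨_, le_antisymm ((hf i.castSucc _).1 le_rfl)
      (not_lt.1 fun h => hlt.not_ge ((hf i.succ _).2 h))⟩
  · rintro ⟨j, hj⟩ heq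
    have hlt : (i : ℕ) + 1 < ∑ a ∈ Finset.Iic j, b a :=
      (hf i.succ j).1 (heq ▸ (hf i.castSucc j).2 (hj ▸ Nat.lt_succ_self _))
    exact hlt.ne hj

theorem interiorNodes_eq [Fintype κ] [OrderTop κ] {f : Fin (m + 1) → κ}
    (hf : IsBlockLabelling b f) (hm : m + 1 = ∑ j, b j) (htop : 0 < b ⊤) :
    interiorNodes f = {i : Fin (m + 1) | ¬ ∃ j ≠ ⊤, (i : ℕ) + 1 = ∑ a ∈ Finset.Iic j, b a} := by
  ext i
  cases i using Fin.lastCases with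
  | last =>
    refine iff_of_true (Set.mem_insert _ _) ?_
    rintro ⟨j, hj, hsum⟩
    have hlt : ∑ a ∈ Finset.Iic j, b a < ∑ a, b a :=
      Finset.sum_lt_sum_of_subset (Finset.subset_univ _) (Finset.mem_univ ⊤)
        (by simpa using hj) htop (fun _ _ _ => Nat.zero_le _)
    exact hlt.ne (hsum.symm.trans hm)
  | cast i =>
    have hne_top : (∃ j ≠ ⊤, (i : ℕ) + 1 = ∑ a ∈ Finset.Iic j, b a) ↔
        ∃ j, (i : ℕ) + 1 = ∑ a ∈ Finset.Iic j, b a := by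
      refine ⟨fun ⟨j, _, h⟩ => ⟨j, h⟩, fun ⟨j, h⟩ => ⟨j, ?_, h⟩⟩
      rintro rfl
      rw [Finset.Iic_top, ← hm] at h
      omega
    have hmem : i.castSucc ∈ interiorNodes f ↔ f i.castSucc = f i.succ := by
      simp [interiorNodes, i.castSucc_lt_last.ne]
    rw [hmem, Set.mem_ofPred_eq, Fin.val_castSucc, hne_top, ← hf.castSucc_ne_succ_iff, not_not]

end IsBlockLabelling

end BlockLabelling

/-! ### Asymptotics of multinomial coefficients -/

section Asymptotics

theorem mul_log_sub_self_le_log_factorial (n : ℕ) :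
    n * Real.log n - n ≤ Real.log n.factorial := by
  rcases eq_or_ne n 0 with rfl | hn
  · simp
  have hlog : 0 ≤ Real.log n := Real.log_natCast_nonneg n
  have hlog_pi : 0 ≤ Real.log (2 * Real.pi) :=
    Real.log_nonneg (by linarith [Real.pi_gt_three])
  linarith [Stirling.le_log_factorial_stirling hn]

theorem log_factorial_le_mul_log_sub_self_add (n : ℕ) :
    Real.log n.factorial ≤ n * Real.log n - n + (1 + Real.log n) := by
  induction n with
  | zero => simp
  | succ n ih =>
    rcases eq_or_ne n 0 with rfl | hn
    · simp
    have hn' : (0 : ℝ) < n := by positivity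
    have hstep : 1 ≤ (n + 1 : ℝ) * (Real.log (n + 1) - Real.log n) := by
      have h := Real.one_sub_inv_le_log_of_pos (x := (n + 1) / n) (by positivity)
      rw [Real.log_div (by positivity) hn'.ne', inv_div] at h
      calc (1 : ℝ) = (n + 1) * (1 - n / (n + 1)) := by field_simp; ring
        _ ≤ _ := by gcongr
    rw [Nat.factorial_succ, Nat.cast_mul, Real.log_mul (by positivity) (by positivity)]
    push_cast
    linarith

variable {κ : Type*}

theorem sum_mul_sum_negMulLog_div (t : Finset κ) {x : κ → ℝ} (hx : ∀ j ∈ t, 0 ≤ x j) :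
    (∑ j ∈ t, x j) * ∑ j ∈ t, Real.negMulLog (x j / ∑ i ∈ t, x i) =
      (∑ j ∈ t, x j) * Real.log (∑ j ∈ t, x j) - ∑ j ∈ t, x j * Real.log (x j) := by
  rw [Finset.mul_sum, Finset.sum_mul, ← Finset.sum_sub_distrib]
  refine Finset.sum_congr rfl fun j hj => ?_
  rcases (hx j hj).eq_or_lt with h0 | hpos
  · simp [← h0]
  have hsum : 0 < ∑ i ∈ t, x i := hpos.trans_le (Finset.single_le_sum hx hj)
  rw [Real.negMulLog, Real.log_div hpos.ne' hsum.ne']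
  field_simp
  ring

theorem log_multinomial (t : Finset κ) (N : κ → ℕ) :
    Real.log (Nat.multinomial t N) =
      Real.log (∑ j ∈ t, N j).factorial - ∑ j ∈ t, Real.log (N j).factorial := by
  rw [← Nat.multinomial_spec, Nat.cast_mul, Nat.cast_prod, Real.log_mul, Real.log_prod,
    add_sub_cancel_left]
  · exact fun j _ => by positivity
  · exact Finset.prod_ne_zero_iff.2 fun j _ => by positivity
  · exact_mod_cast (Nat.multinomial_pos t N).ne'

theorem abs_log_multinomial_sub_le (t : Finset κ) (N : κ → ℕ) {s : ℕ} (hs : ∑ j ∈ t, N j = s) :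
    |Real.log (Nat.multinomial t N) - s * ∑ j ∈ t, Real.negMulLog (N j / s)| ≤
      (t.card + 1) * (1 + Real.log s) := by
  set E : ℕ → ℝ := fun n => Real.log n.factorial - (n * Real.log n - n) with hE
  have hE_nonneg (n : ℕ) : 0 ≤ E n := sub_nonneg.2 (mul_log_sub_self_le_log_factorial n)
  have hE_le (n : ℕ) : E n ≤ 1 + Real.log n :=
    sub_le_iff_le_add'.2 (log_factorial_le_mul_log_sub_self_add n)
  have hcast : ∑ j ∈ t, (N j : ℝ) = s := by exact_mod_cast hs
  have hentropy := sum_mul_sum_negMulLog_div t (x := fun j => (N j : ℝ))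
    fun j _ => Nat.cast_nonneg _
  have hdiff : Real.log (Nat.multinomial t N) - s * ∑ j ∈ t, Real.negMulLog (N j / s) =
      E s - ∑ j ∈ t, E (N j) := by
    rw [hcast] at hentropy
    simp only [hE, log_multinomial, hs, Finset.sum_sub_distrib, hcast]
    linarith
  have hsum_nonneg : 0 ≤ ∑ j ∈ t, E (N j) := Finset.sum_nonneg fun j _ => hE_nonneg _
  have hsum_le : ∑ j ∈ t, E (N j) ≤ t.card * (1 + Real.log s) := by
    rw [← nsmul_eq_mul]
    refine Finset.sum_le_card_nsmul _ _ _ fun j hj => (hE_le _).trans ?_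
    rcases Nat.eq_zero_or_pos (N j) with h0 | hpos
    · simp [h0, Real.log_natCast_nonneg]
    have hle : N j ≤ s := hs ▸ Finset.single_le_sum (fun _ _ => Nat.zero_le _) hj
    gcongr
  have hlog : 0 ≤ Real.log s := Real.log_natCast_nonneg s
  rw [hdiff, abs_le]
  constructor <;> linarith [hE_nonneg s, hE_le s]

theorem tendsto_log_multinomial_div {α : Type*} {l : Filter α} (t : Finset κ) {N : α → κ → ℕ}
    {s : α → ℕ} {p : κ → ℝ} (hsum : ∀ᶠ a in l, ∑ j ∈ t, N a j = s a) (hs : Tendsto s l atTop)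
    (hp : ∀ j ∈ t, Tendsto (fun a => (N a j / s a : ℝ)) l (𝓝 (p j))) :
    Tendsto (fun a => Real.log (Nat.multinomial t (N a)) / s a) l
      (𝓝 (∑ j ∈ t, Real.negMulLog (p j))) := by
  have hs' : Tendsto (fun a => (s a : ℝ)) l atTop := tendsto_natCast_atTop_atTop.comp hs
  have hentropy : Tendsto (fun a => ∑ j ∈ t, Real.negMulLog (N a j / s a)) l
      (𝓝 (∑ j ∈ t, Real.negMulLog (p j))) :=
    tendsto_finsetSum t fun j hj => (Real.continuous_negMulLog.tendsto _).comp (hp j hj)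
  have herror : Tendsto (fun a => (t.card + 1) * ((s a : ℝ)⁻¹ + Real.log (s a) / s a)) l (𝓝 0) := by
    have hlog := Real.isLittleO_log_id_atTop.tendsto_div_nhds_zero.comp hs'
    simpa using (hs'.inv_tendsto_atTop.add hlog).const_mul ((t.card : ℝ) + 1)
  refine (tendsto_iff_of_dist (squeeze_zero' (.of_forall fun _ => dist_nonneg) ?_ herror)).1
    hentropy
  filter_upwards [hsum, hs.eventually_gt_atTop 0] with a ha hpos
  have hpos' : (0 : ℝ) < s a := Nat.cast_pos.2 hpos
  rw [dist_comm, Real.dist_eq, ← mul_le_mul_iff_of_pos_left hpos', ← abs_of_pos hpos', ← abs_mul,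
    abs_of_pos hpos', mul_sub, mul_div_cancel₀ _ hpos'.ne']
  refine (abs_log_multinomial_sub_le t (N a) ha).trans_eq ?_
  field_simp

end Asymptotics

/-! ### The index of a parabolic subgroup -/

section ParabolicSubgroups

variable {k n : ℕ} {P : Fin (k + 1) → ℚ}

/-- The sizes of the blocks into which `P` cuts the `n - 1` coordinates on which the reflection
group acts: `n p_j`, except that the last block, which carries the sign changes, loses one
coordinate because the diagram has `n - 1` and not `n` nodes. -/
def blockSize (P : Fin (k + 1) → ℚ) (n : ℕ) (j : Fin (k + 1)) : ℕ :=
  ⌊n * P j⌋₊ - if j = Fin.last k then 1 else 0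

theorem cast_blockSize (hn : n ∈ admissible P) (j : Fin (k + 1)) :
    (blockSize P n j : ℚ) = n * P j - if j = Fin.last k then 1 else 0 := by
  obtain ⟨⟨a, ha⟩, h3⟩ := hn.2 j
  have ha3 : 3 < a := by exact_mod_cast ha ▸ h3
  lift a to ℕ using by omega
  rw [blockSize, ha, Int.cast_natCast, Nat.floor_natCast, Nat.cast_sub (by split_ifs <;> omega),
    Nat.cast_ite, Nat.cast_one, Nat.cast_zero]

theorem three_le_blockSize (hn : n ∈ admissible P) (j : Fin (k + 1)) : 3 ≤ blockSize P n j := by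
  have h3 := (hn.2 j).2
  have hlt : (2 : ℚ) < blockSize P n j := by
    rw [cast_blockSize hn]
    split_ifs <;> linarith
  exact_mod_cast hlt

theorem sum_blockSize_add_one (hP : ∑ i, P i = 1) (hn : n ∈ admissible P) :
    ∑ j, blockSize P n j + 1 = n := by
  have hcast : (∑ j, blockSize P n j + 1 : ℚ) = n := by
    simp [cast_blockSize hn, ← Finset.mul_sum, hP]
  exact_mod_cast hcast

theorem isExcluded_iff (hn : n ∈ admissible P) {m : ℕ} (i : Fin m) :
    IsExcluded P n i ↔ ∃ j ≠ ⊤, (i : ℕ) + 1 = ∑ a ∈ Finset.Iic j, blockSize P n a := by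
  refine exists_congr fun j => and_congr_right fun hj => ?_
  have hsum : n * ∑ a ∈ Finset.Iic j, P a = ∑ a ∈ Finset.Iic j, (blockSize P n a : ℚ) := by
    rw [Finset.mul_sum]
    refine Finset.sum_congr rfl fun a ha => ?_
    have ha' : a ≠ Fin.last k :=
      ((Finset.mem_Iic.1 ha).trans_lt (lt_top_iff_ne_top.2 hj)).ne
    rw [cast_blockSize hn, if_neg ha', sub_zero]
  rw [hsum]
  exact_mod_cast Iff.rfl

variable {V : Type*} [NormedAddCommGroup V] [InnerProductSpace ℝ V]

theorem relIndex_parabolicSubgroup (hP : ∑ i, P i = 1) (hn : n ∈ admissible P) {m : ℕ}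
    (hm : m + 1 = n) {X : DynkinFamily} {Φ : Set V} {Δ : Fin m → V} (hΦ : IsRootSystem Φ)
    (hΔ : IsFundamentalSystem Φ Δ) (hX : HasDynkinDiagram X Δ) :
    (parabolicSubgroup P n Δ).relIndex (reflectionGroup Φ) =
      Nat.multinomial Finset.univ (blockSize P n) * 2 ^ (m - blockSize P n (Fin.last k)) := by
  set b := blockSize P n with hb
  have hsum : m = ∑ j, b j :=
    Nat.succ_injective (hm.trans (sum_blockSize_add_one hP hn).symm)
  have hlast : 3 ≤ b ⊤ := three_le_blockSize hn _
  have hhead : b ⊤ + ∑ a ∈ Finset.Iio ⊤, b a = m := by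
    rw [hsum, ← Finset.Iic_top, Finset.Iic_eq_cons_Iio, Finset.sum_cons]
  obtain ⟨m, rfl⟩ : ∃ m', m = m' + 2 := Nat.exists_eq_add_of_le' (by omega)
  obtain ⟨f, hf⟩ := exists_isBlockLabelling hsum.le
  have hf_last : f (Fin.last (m + 1)) = ⊤ :=
    (hf.eq_top_iff _).2 (by rw [Fin.val_last]; omega)
  have hf_penultimate : f (Fin.last m).castSucc = ⊤ :=
    (hf.eq_top_iff _).2 (by rw [Fin.val_castSucc, Fin.val_last]; omega)
  have hnodes : {i : Fin (m + 2) | ¬ IsExcluded P n i} = interiorNodes f := by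
    rw [hf.interiorNodes_eq hsum (by omega)]
    simp only [isExcluded_iff hn, hb]
  have hcompl : Finset.card {i | f i ≠ ⊤} = m + 2 - b ⊤ := by
    rw [← hf.card_fiber hsum ⊤, ← Finset.compl_filter, Finset.card_compl, Fintype.card_fin]
  rw [parabolicSubgroup, hnodes, ← hΔ.reflectionGroup_range hΦ,
    hX.relIndex_reflectionGroup (fun i => hΦ.ne_zero _ (hΔ.mem i)) (by omega) hf.monotone
      (hf_penultimate.trans hf_last.symm),
    SignedPerm.index_blockSubgroup, hf_last, hcompl]
  simp only [hf.card_fiber hsum]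
  rfl

theorem tendsto_blockSize_div (P : Fin (k + 1) → ℚ) (j : Fin (k + 1)) :
    Tendsto (fun n : ℕ => (blockSize P n j / (n - 1 : ℕ) : ℝ)) (atTop ⊓ 𝓟 (admissible P))
      (𝓝 (P j)) := by
  set δ : ℝ := if j = Fin.last k then 1 else 0
  have hlim : Tendsto (fun n : ℕ => P j + (P j - δ) * (((n - 1 : ℕ) : ℝ))⁻¹)
      (atTop ⊓ 𝓟 (admissible P)) (𝓝 (P j)) := by
    have hinv : Tendsto (fun n : ℕ => (((n - 1 : ℕ) : ℝ))⁻¹) atTop (𝓝 0) :=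
      (tendsto_natCast_atTop_atTop.comp (tendsto_sub_atTop_nat 1)).inv_tendsto_atTop
    simpa using ((hinv.const_mul (P j - δ)).const_add (P j : ℝ)).mono_left inf_le_left
  refine hlim.congr' ?_
  filter_upwards [mem_inf_of_right (mem_principal_self _),
    mem_inf_of_left (eventually_ge_atTop 2)] with n hn hn2
  have hb : (blockSize P n j : ℝ) = n * P j - δ := by
    simpa only [Rat.cast_natCast, Rat.cast_sub, Rat.cast_mul, apply_ite (Rat.cast : ℚ → ℝ),
      Rat.cast_one, Rat.cast_zero] using congrArg (Rat.cast : ℚ → ℝ) (cast_blockSize hn j)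
  have hpos : (0 : ℝ) < n - 1 := by
    have : (2 : ℝ) ≤ n := by exact_mod_cast hn2
    linarith
  rw [hb, Nat.cast_pred hn.1]
  field_simp
  ring

theorem tendsto_log_multinomial_blockSize (hP : ∑ i, P i = 1) :
    Tendsto
      (fun n : ℕ => 1 / (n : ℝ) * Real.log (Nat.multinomial Finset.univ (blockSize P n) *
        2 ^ (n - 1 - blockSize P n (Fin.last k)) : ℕ))
      (atTop ⊓ 𝓟 (admissible P)) (𝓝 (reflectiveEntropy P)) := by
  have hadm : ∀ᶠ n in atTop ⊓ 𝓟 (admissible P), n ∈ admissible P :=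
    mem_inf_of_right (mem_principal_self _)
  have hsum : ∀ᶠ n in atTop ⊓ 𝓟 (admissible P), ∑ j, blockSize P n j = n - 1 :=
    hadm.mono fun n hn => Nat.eq_sub_of_add_eq (sum_blockSize_add_one hP hn)
  have hperm := tendsto_log_multinomial_div Finset.univ hsum
    ((tendsto_sub_atTop_nat 1).mono_left inf_le_left) fun j _ => tendsto_blockSize_div P j
  have hsign := ((tendsto_blockSize_div P (Fin.last k)).const_sub 1).mul_const (Real.log 2)
  have hratio : Tendsto (fun n : ℕ => ((n - 1 : ℕ) / n : ℝ)) (atTop ⊓ 𝓟 (admissible P)) (𝓝 1) := by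
    have h : Tendsto (fun n : ℕ => 1 - (n : ℝ)⁻¹) atTop (𝓝 1) := by
      simpa using tendsto_inv_atTop_nhds_zero_nat.const_sub (1 : ℝ)
    refine (h.mono_left inf_le_left).congr' ?_
    filter_upwards [hadm] with n hn
    have hpos : (0 : ℝ) < n := Nat.cast_pos.2 hn.1
    rw [Nat.cast_pred hn.1]
    field_simp
  have hlim : reflectiveEntropy P = 1 * (∑ j, Real.negMulLog (P j) +
      (1 - (P (Fin.last k) : ℝ)) * Real.log 2) := by
    simp [reflectiveEntropy, shannonEntropy, Real.negMulLog]
  rw [hlim]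
  refine (hratio.mul (hperm.add hsign)).congr' ?_
  filter_upwards [hsum, hadm] with n hn hn_adm
  have hlast : blockSize P n (Fin.last k) ≤ n - 1 :=
    hn ▸ Finset.single_le_sum (fun _ _ => Nat.zero_le _) (Finset.mem_univ _)
  have hpos : (0 : ℝ) < (n - 1 : ℕ) := by
    have := three_le_blockSize hn_adm (Fin.last k)
    exact_mod_cast (by omega : 0 < n - 1)
  rw [Nat.cast_mul, Nat.cast_pow, Real.log_mul (by exact_mod_cast (Nat.multinomial_pos _ _).ne')
    (by positivity), Real.log_pow, Nat.cast_sub hlast, Nat.cast_ofNat]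
  field_simp

end ParabolicSubgroups

end ReflectiveEntropy

theorem mainTheorem2_general (X : ℕ → DynkinFamily) (k : ℕ) (P : Fin (k + 1) → ℚ)
    (hP_sum : ∑ i, P i = 1)
    (V : ℕ → Type*) [∀ n, NormedAddCommGroup (V n)] [∀ n, InnerProductSpace ℝ (V n)]
    (Φ : ∀ n, Set (V n)) (Δ : ∀ n, Fin (n - 1) → V n)
    (hΦ : ∀ n ∈ admissible P, IsRootSystem (Φ n))
    (hΔ : ∀ n ∈ admissible P, IsFundamentalSystem (Φ n) (Δ n))
    (hX : ∀ n ∈ admissible P, HasDynkinDiagram (X n) (Δ n))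
    (W : ∀ n, Subgroup (V n ≃ₗᵢ[ℝ] V n))
    (hW : ∀ n ∈ admissible P, W n = reflectionGroup (Φ n)) :
    Tendsto
      (fun n : ℕ =>
        1 / (n : ℝ) * Real.log (Nat.card (W n ⧸ (parabolicSubgroup P n (Δ n)).subgroupOf (W n))))
      (atTop ⊓ 𝓟 (admissible P))
      (𝓝 (reflectiveEntropy P)) := by
  refine (tendsto_log_multinomial_blockSize hP_sum).congr' ?_
  filter_upwards [mem_inf_of_right (mem_principal_self _)] with n hn
  have hindex := relIndex_parabolicSubgroup hP_sum hn (Nat.sub_add_cancel hn.1) (hΦ n hn)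
    (hΔ n hn) (hX n hn)
  rw [← hindex, ← hW n hn]
  rfl

theorem mainTheorem2 (X : DynkinFamily) (k : ℕ) (P : Fin (k + 1) → ℚ)
    (hP_pos : ∀ i, 0 < P i) (hP_sum : ∑ i, P i = 1)
    (V : ℕ → Type*) [∀ n, NormedAddCommGroup (V n)] [∀ n, InnerProductSpace ℝ (V n)]
    [∀ n, FiniteDimensional ℝ (V n)]
    (Φ : ∀ n, Set (V n)) (Δ : ∀ n, Fin (n - 1) → V n)
    (hΦ : ∀ n ∈ admissible P, IsRootSystem (Φ n))
    (hΔ : ∀ n ∈ admissible P, IsFundamentalSystem (Φ n) (Δ n))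
    (hX : ∀ n ∈ admissible P, HasDynkinDiagram X (Δ n))
    (W : ∀ n, Subgroup (V n ≃ₗᵢ[ℝ] V n))
    (hW : ∀ n ∈ admissible P, W n = reflectionGroup (Φ n)) :
    Tendsto
      (fun n : ℕ =>
        1 / (n : ℝ) * Real.log (Nat.card (W n ⧸ (parabolicSubgroup P n (Δ n)).subgroupOf (W n))))
      (atTop ⊓ 𝓟 (admissible P))
      (𝓝 (reflectiveEntropy P)) :=
  mainTheorem2_general (fun _ => X) k P hP_sum V Φ Δ hΦ hΔ hX W hW
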